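/- Let $\mathbb S^1=\mathbb R/\mathbb Z$ with its usual metric $d$, and let $f:\mathbb S^1\to\mathbb S^1$ be a $C^2$ expanding map, i.e. there is $c>1$ with $|f'(x)|\ge c$ for all $x\in\mathbb S^1$. For $K\subset\mathbb S^1$, $n\ge 1$ and $\varepsilon>0$ let $S(n,\varepsilon,K)$ be the maximal cardinality of a set $E\subset K$ such that for all distinct $x,y\in E$ there is $0\le j<n$ with $d(f^j(x),f^j(y))\ge\varepsilon$. Put $$h_{\rm top}(f)=\lim_{\varepsilon\to0}\limsup_{n\to\infty}\frac1n\log S(n,\varepsilon,\mathbb S^1),$$ and for $\omega\ge0$ and $z\in\mathbb S^1$ define the upper translocal entropy $$\overline h_\omega(z)=\max\Big\{\lim_{\varepsilon\to0}\limsup_{n\to\infty}\frac1n\log S\big(n,\varepsilon,\overline{B(z,e^{-\omega n})}\big),\,0\Big\},$$ and the lower translocal entropy $\underline h_\omega(z)$ by the same formula with $\liminf_{n\to\infty}$ in place of $\limsup_{n\to\infty}$. Let $$\overline\lambda(z)=\limsup_{n\to\infty}\frac1n\log|(f^n)'(z)|,\qquad \underline\lambda(z)=\liminf_{n\to\infty}\frac1n\log|(f^n)'(z)|$$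 be the upper and lower Lyapunov exponents at $z$. **Theorem.** For every $\omega\ge0$ and every $z\in\mathbb S^1$, $$\overline h_\omega(z)=\max\Big\{\Big(1-\frac{\omega}{\overline\lambda(z)}\Big)h_{\rm top}(f),\,0\Big\}\qquad\text{and}\qquad \underline h_\omega(z)=\max\Big\{\Big(1-\frac{\omega}{\underline\lambda(z)}\Big)h_{\rm top}(f),\,0\Big\}.$$ -/

import Mathlib

open Filter Topology
open scoped ENNReal

noncomputable section

namespace Translocal

section Entropy

variable {X : Type*} [PseudoMetricSpace X]

/-- `E` is `(n, ε)`-separated for `f`: distinct points of `E` do not lie in each other's Bowen ball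
`B_n(x; ε) = {y | d(f^j x, f^j y) < ε for all 0 ≤ j < n}`. -/
def IsSeparated (f : X → X) (n : ℕ) (ε : ℝ) (E : Set X) : Prop :=
  ∀ x ∈ E, ∀ y ∈ E, x ≠ y → ∃ j < n, ε ≤ dist (f^[j] x) (f^[j] y)

/-- `S(n, ε, K)`: the maximal cardinality of an `(n, ε)`-separated subset of `K`
(a value in `ℕ∞`; it is finite for continuous `f` on a compact space). -/
def maxSep (f : X → X) (n : ℕ) (ε : ℝ) (K : Set X) : ℕ∞ :=
  ⨆ (E : Finset X) (_ : (E : Set X) ⊆ K ∧ IsSeparated f n ε (E : Set X)), (E.card : ℕ∞)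

/-- `(1/n) log S(n, ε, K)`, as an extended real. -/
def sepRate (f : X → X) (n : ℕ) (ε : ℝ) (K : Set X) : EReal :=
  ENNReal.log ((maxSep f n ε K : ℕ∞) : ℝ≥0∞) / (n : EReal)

/-- `lim_{ε → 0} limsup_{n → ∞} (1/n) log S(n, ε, K n)` for a sequence of sets `K`. The inner
expression increases as `ε` decreases, so the limit is the supremum over `ε > 0`
(see `tendsto_upperRate`). -/
def upperRate (f : X → X) (K : ℕ → Set X) : EReal :=
  ⨆ (ε : ℝ) (_ : 0 < ε), limsup (fun n : ℕ => sepRate f n ε (K n)) atTop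

/-- `lim_{ε → 0} liminf_{n → ∞} (1/n) log S(n, ε, K n)` for a sequence of sets `K`; again the
limit is a supremum (see `tendsto_lowerRate`). -/
def lowerRate (f : X → X) (K : ℕ → Set X) : EReal :=
  ⨆ (ε : ℝ) (_ : 0 < ε), liminf (fun n : ℕ => sepRate f n ε (K n)) atTop

/-- The topological entropy of `f` restricted to `K`. -/
def topEntropyOn (f : X → X) (K : Set X) : EReal :=
  upperRate f (fun _ => K)

/-- The topological entropy of `f`. -/
def topEntropy (f : X → X) : EReal :=
  topEntropyOn f Set.univ

/-- The upper translocal entropy of `f` at `z`. -/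
def upperTranslocalEntropy (f : X → X) (ω : ℝ) (z : X) : EReal :=
  max (upperRate f (fun n => closure (Metric.ball z (Real.exp (-ω * n))))) 0

/-- The lower translocal entropy of `f` at `z`. -/
def lowerTranslocalEntropy (f : X → X) (ω : ℝ) (z : X) : EReal :=
  max (lowerRate f (fun n => closure (Metric.ball z (Real.exp (-ω * n))))) 0

theorem maxSep_anti (f : X → X) (n : ℕ) (K : Set X) : Antitone fun ε => maxSep f n ε K := by
  intro ε ε' h
  refine iSup_mono fun E => iSup_mono' fun hE => ⟨⟨hE.1, fun x hx y hy hxy => ?_⟩, le_rfl⟩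
  obtain ⟨j, hj, hd⟩ := hE.2 x hx y hy hxy
  exact ⟨j, hj, h.trans hd⟩

theorem sepRate_anti (f : X → X) (n : ℕ) (K : Set X) : Antitone fun ε => sepRate f n ε K := by
  intro ε ε' h
  refine EReal.div_le_div_right_of_nonneg (by positivity) ?_
  exact ENNReal.log_monotone (by exact_mod_cast maxSep_anti f n K h)

theorem tendsto_iSup_of_antitone {g : ℝ → EReal} (hg : Antitone g) :
    Tendsto g (𝓝[>] 0) (𝓝 (⨆ (ε : ℝ) (_ : 0 < ε), g ε)) := by
  have h := hg.tendsto_nhdsGT 0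
  rwa [sSup_image] at h

/-- `upperRate` is the limit as `ε → 0`. -/
theorem tendsto_upperRate (f : X → X) (K : ℕ → Set X) :
    Tendsto (fun ε => limsup (fun n : ℕ => sepRate f n ε (K n)) atTop) (𝓝[>] 0)
      (𝓝 (upperRate f K)) :=
  tendsto_iSup_of_antitone fun _ _ h =>
    limsup_le_limsup (Eventually.of_forall fun n => sepRate_anti f n (K n) h)

/-- `lowerRate` is the limit as `ε → 0`. -/
theorem tendsto_lowerRate (f : X → X) (K : ℕ → Set X) :
    Tendsto (fun ε => liminf (fun n : ℕ => sepRate f n ε (K n)) atTop) (𝓝[>] 0)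
      (𝓝 (lowerRate f K)) :=
  tendsto_iSup_of_antitone fun _ _ h =>
    liminf_le_liminf (Eventually.of_forall fun n => sepRate_anti f n (K n) h)

end Entropy

section Circle

/-- The representative in `[-1/2, 1/2)` of a point of the circle `ℝ/ℤ`: the standard local
coordinate near `0`. -/
def circleCoord (w : UnitAddCircle) : ℝ :=
  (AddCircle.equivIco (1 : ℝ) (-1 / 2) w : ℝ)

/-- The derivative at `z` of a circle map `f`, in the standard coordinates: the derivative at
`t = 0` of `t ↦ f(z + t) - f(z)`, with small elements of `ℝ/ℤ` identified with real numbers. -/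
def circleDeriv (f : UnitAddCircle → UnitAddCircle) (z : UnitAddCircle) : ℝ :=
  deriv (fun t : ℝ => circleCoord (f (z + (t : UnitAddCircle)) - f z)) 0

/-- A circle map is `C²` if it lifts to a `C²` map of the real line. -/
def IsC2CircleMap (f : UnitAddCircle → UnitAddCircle) : Prop :=
  ∃ F : ℝ → ℝ, ContDiff ℝ 2 F ∧ ∀ x : ℝ, f (x : UnitAddCircle) = (F x : UnitAddCircle)

/-- A `C²` expanding circle map: `|f'| ≥ c` everywhere for some constant `c > 1`. -/
structure IsC2ExpandingCircleMap (f : UnitAddCircle → UnitAddCircle) : Prop where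
  isC2 : IsC2CircleMap f
  expanding : ∃ c : ℝ, 1 < c ∧ ∀ z, c ≤ |circleDeriv f z|

/-- `(1/n) log |Df^n(z)|`. -/
def lyapunovRate (f : UnitAddCircle → UnitAddCircle) (n : ℕ) (z : UnitAddCircle) : ℝ :=
  Real.log |circleDeriv f^[n] z| / n

/-- The upper Lyapunov exponent of `f` at `z`. -/
def upperLyapunov (f : UnitAddCircle → UnitAddCircle) (z : UnitAddCircle) : EReal :=
  limsup (fun n : ℕ => (lyapunovRate f n z : EReal)) atTop

/-- The lower Lyapunov exponent of `f` at `z`. -/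
def lowerLyapunov (f : UnitAddCircle → UnitAddCircle) (z : UnitAddCircle) : EReal :=
  liminf (fun n : ℕ => (lyapunovRate f n z : EReal)) atTop

end Circle

end Translocal

end

/-! Work with a lift `F` of `f` to the line, with `F (x + 1) = F x + d` and `c ≤ |F'| ≤ M`, `c > 1`.
The iterates are monotone or antitone and never contract, so separation on an arc is decided by the
last iterate: up to factors depending only on `ε` and `M`, the maximal separated subset of a short
arc has as many points as 1 plus the length of its `n`-th image (`maxSep_le`, `le_maxSep`). A unit
interval has `n`-th image of length exactly `|d| ^ n`, whence `h_top = log |d|` (`rate_univ`).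

For `ω > 0`, let `k n` be the first time at which the image of the interval of radius `exp (-ω n)`
about `x` has length at least 1. That length is at most `M`, and from then on it grows like `|d| ^
(n - k n)` (`exists_hitting_time`). Hence the counting rate is `(n - k n)⁺ / n * log |d|` up to `O(1
/ n)`. Bounded distortion makes the derivative at `x` comparable to the average expansion over the
interval, so `log |(F^k)' x| = ω n + O(1)` at `k = k n` (`abs_log_deriv_add_log_le`). Thus `k n / n`
is asymptotically `ω` divided by the finite-time exponent at time `k n`.

Since every time `j` lies within bounded distance of some `k n`, the finite-time exponents have the
same upper and lower limits along `k n` as along all times. As `t ↦ max (1 - ω / t) 0` is continuous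
and increasing on `t > 0`, it carries upper limits to upper limits and lower to lower
(`limsup_liminf_hitting`). The case `ω = 0` is just the entropy of the whole circle. -/

namespace Translocal

/-! ### Expanding lifts of circle maps -/

/-- `F` lifts a circle map of degree `d` with `c ≤ |F'| ≤ M` and `log |F'|` Lipschitz. -/
structure IsExpandingLift (F : ℝ → ℝ) (d : ℤ) (c M D : ℝ) : Prop where
  differentiable : Differentiable ℝ F
  one_lt : 1 < c
  le_deriv : ∀ x, c ≤ |deriv F x|
  deriv_le : ∀ x, |deriv F x| ≤ M
  log_deriv_lipschitz : ∀ x y, |Real.log |deriv F x| - Real.log (|deriv F y|)| ≤ D * |x - y|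
  map_add_one : ∀ x, F (x + 1) = F x + d

theorem abs_log_sub_log_le_of_one_le {a b : ℝ} (ha : 1 ≤ a) (hb : 1 ≤ b) :
    |Real.log a - Real.log b| ≤ |a - b| := by
  have key : ∀ {u v : ℝ}, 1 ≤ u → 1 ≤ v → Real.log u - Real.log v ≤ |u - v| := by
    intro u v hu hv
    have hv0 : 0 < v := by linarith
    have hu0 : 0 < u := by linarith
    rw [← Real.log_div hu0.ne' hv0.ne']
    calc Real.log (u / v) ≤ u / v - 1 := Real.log_le_sub_one_of_pos (by positivity)
      _ = (u - v) / v := by field_simp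
      _ ≤ |u - v| / v := by gcongr; exact le_abs_self _
      _ ≤ |u - v| := div_le_self (abs_nonneg _) hv
  rw [abs_le]
  have h1 := key ha hb
  have h2 := key hb ha
  rw [abs_sub_comm] at h2
  constructor <;> linarith

theorem exists_int_map_add_one {F : ℝ → ℝ} (hF : Continuous F)
    (h : ∀ x, ∃ m : ℤ, F (x + 1) - F x = m) : ∃ d : ℤ, ∀ x, F (x + 1) = F x + d := by
  have hcont : Continuous fun x => F (x + 1) - F x := by fun_prop
  -- A continuous integer-valued function on the connected line is constant; its value is the
  -- degree.
  have hdisc : IsDiscrete (Set.range ((↑) : ℤ → ℝ)) :=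
    Int.isClosedEmbedding_coe_real.isEmbedding.isDiscrete_range
  obtain ⟨y, ⟨d, rfl⟩, hy⟩ := isPreconnected_univ.eqOn_const_of_mapsTo hdisc
    hcont.continuousOn (fun x _ => by obtain ⟨m, hm⟩ := h x; exact ⟨m, hm.symm⟩) ⟨0, 0, by simp⟩
  refine ⟨d, fun x => ?_⟩
  have := hy (Set.mem_univ x)
  simp only [Function.const_apply] at this
  linarith

theorem coe_add_int (x : ℝ) (m : ℤ) : ((x + m : ℝ) : UnitAddCircle) = (x : UnitAddCircle) := by
  rw [AddCircle.coe_add]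
  have : ((m : ℝ) : UnitAddCircle) = 0 := (AddCircle.coe_eq_zero_iff 1).2 ⟨m, by simp⟩
  simp [this]

theorem circleCoord_coe {t : ℝ} (ht : |t| < 1 / 2) : circleCoord (t : UnitAddCircle) = t := by
  unfold circleCoord
  have : ((AddCircle.equivIco (1 : ℝ) (-1 / 2)) (t : UnitAddCircle) : ℝ)
      = toIcoMod one_pos (-1 / 2) t := rfl
  rw [this, toIcoMod_eq_self]
  rw [abs_lt] at ht
  constructor <;> linarith [ht.1, ht.2]

theorem circleDeriv_coe {g : UnitAddCircle → UnitAddCircle} {G : ℝ → ℝ} (hG : Continuous G)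
    (hgG : ∀ x : ℝ, g (x : UnitAddCircle) = (G x : UnitAddCircle)) (x : ℝ) :
    circleDeriv g (x : UnitAddCircle) = deriv G x := by
  unfold circleDeriv
  have hev : (fun t : ℝ => circleCoord (g ((x : UnitAddCircle) + (t : UnitAddCircle))
      - g (x : UnitAddCircle))) =ᶠ[𝓝 0] fun t => G (x + t) - G x := by
    have hc : Tendsto (fun t => |G (x + t) - G x|) (𝓝 0) (𝓝 |G (x + 0) - G x|) :=
      Continuous.tendsto (by fun_prop) 0
    -- Increments below `1 / 2` do not wrap around, so near `t = 0` the circle coordinate is the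
    -- increment of the lift itself.
    have := hc.eventually (gt_mem_nhds (show |G (x + 0) - G x| < 1 / 2 by simp))
    filter_upwards [this] with t ht
    rw [← AddCircle.coe_add, hgG, hgG, ← AddCircle.coe_sub, circleCoord_coe ht]
  rw [hev.deriv_eq, deriv_sub_const, deriv_comp_const_add, add_zero]

theorem iterate_coe {f : UnitAddCircle → UnitAddCircle} {F : ℝ → ℝ}
    (h : ∀ x : ℝ, f (x : UnitAddCircle) = (F x : UnitAddCircle)) (n : ℕ) (x : ℝ) :
    f^[n] (x : UnitAddCircle) = (F^[n] x : UnitAddCircle) := by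
  induction n generalizing x with
  | zero => rfl
  | succ n ih => rw [Function.iterate_succ_apply, Function.iterate_succ_apply, h, ih]

theorem IsC2ExpandingCircleMap.exists_lift {f : UnitAddCircle → UnitAddCircle}
    (hf : IsC2ExpandingCircleMap f) : ∃ (F : ℝ → ℝ) (d : ℤ) (c M D : ℝ),
      IsExpandingLift F d c M D ∧ ∀ x : ℝ, f (x : UnitAddCircle) = (F x : UnitAddCircle) := by
  obtain ⟨F, hF, hfF⟩ := hf.isC2
  obtain ⟨c, hc, hcf⟩ := hf.expanding
  have hdF : Differentiable ℝ F := hF.differentiable (by norm_num)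
  have hF1 : ContDiff ℝ 1 (deriv F) := by
    have : ContDiff ℝ (1 + 1) F := by norm_num; exact hF
    exact (contDiff_succ_iff_deriv.1 this).2.2
  have hddF : Differentiable ℝ (deriv F) := hF1.differentiable (by norm_num)
  have hlow : ∀ x, c ≤ |deriv F x| := fun x => by
    rw [← circleDeriv_coe hdF.continuous hfF]; exact hcf _
  obtain ⟨d, hd⟩ := exists_int_map_add_one hdF.continuous fun x => by
    have : ((F (x + 1) - F x : ℝ) : UnitAddCircle) = 0 := by
      have h1 := coe_add_int x 1
      rw [Int.cast_one] at h1
      rw [AddCircle.coe_sub, ← hfF, ← hfF, h1, sub_self]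
    obtain ⟨m, hm⟩ := (AddCircle.coe_eq_zero_iff 1).1 this
    exact ⟨m, by simpa using hm.symm⟩
  -- `F` is not periodic, but its first two derivatives are, hence they are bounded: this gives `M`
  -- and `D`.
  have hper : Function.Periodic (deriv F) 1 := fun x => by
    rw [← deriv_comp_add_const, funext hd, deriv_add_const]
  have hper2 : Function.Periodic (deriv (deriv F)) 1 := fun x => by
    rw [← deriv_comp_add_const, funext hper]
  obtain ⟨M, hM⟩ := (hper.isBounded_of_continuous one_ne_zero hF1.continuous).exists_norm_le
  obtain ⟨D, hD⟩ := (hper2.isBounded_of_continuous one_ne_zero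
    (hF1.continuous_deriv le_rfl)).exists_norm_le
  refine ⟨F, d, c, M, D, ⟨hdF, hc, hlow, fun x => hM _ ⟨x, rfl⟩, fun x y => ?_, hd⟩, hfF⟩
  -- The logarithm is 1-Lipschitz on `[1, ∞)`, where `|F'|` takes its values, so a bound for `|F''|`
  -- serves as Lipschitz constant.
  refine (abs_log_sub_log_le_of_one_le (hc.le.trans (hlow x)) (hc.le.trans (hlow y))).trans ?_
  refine (abs_abs_sub_abs_le_abs_sub _ _).trans ?_
  exact Convex.norm_image_sub_le_of_norm_deriv_le (fun x _ => hddF x) (fun x _ => hD _ ⟨x, rfl⟩)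
    convex_univ (Set.mem_univ y) (Set.mem_univ x)

/-! ### Expansion, degree and distortion of the iterates of a lift -/

namespace IsExpandingLift

variable {F : ℝ → ℝ} {d : ℤ} {c M D : ℝ}

theorem M_gt_one (h : IsExpandingLift F d c M D) : 1 < M :=
  h.one_lt.trans_le ((h.le_deriv 0).trans (h.deriv_le 0))

theorem D_nonneg (h : IsExpandingLift F d c M D) : 0 ≤ D := by
  simpa using (abs_nonneg _).trans (h.log_deriv_lipschitz 1 0)

theorem map_sub_le (h : IsExpandingLift F d c M D) (x y : ℝ) : |F x - F y| ≤ M * |x - y| :=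
  Convex.norm_image_sub_le_of_norm_deriv_le (fun x _ => h.differentiable x)
    (fun x _ => h.deriv_le x) convex_univ (Set.mem_univ y) (Set.mem_univ x)

theorem le_map_sub (h : IsExpandingLift F d c M D) (x y : ℝ) : c * |x - y| ≤ |F x - F y| := by
  wlog hxy : y < x generalizing x y
  · rcases eq_or_lt_of_le (not_lt.1 hxy) with rfl | hlt
    · simp
    · rw [abs_sub_comm, abs_sub_comm (F x)]; exact this y x hlt
  obtain ⟨ξ, -, hξ⟩ := exists_deriv_eq_slope F hxy h.differentiable.continuous.continuousOn
    h.differentiable.differentiableOn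
  have hpos : 0 < x - y := sub_pos.2 hxy
  have : F x - F y = deriv F ξ * (x - y) := by rw [hξ]; field_simp
  rw [this, abs_mul]
  gcongr
  exact h.le_deriv ξ

theorem le_iterate_sub (h : IsExpandingLift F d c M D) (n : ℕ) (x y : ℝ) :
    c ^ n * |x - y| ≤ |F^[n] x - F^[n] y| := by
  have hc := h.one_lt
  induction n with
  | zero => simp
  | succ n ih =>
    rw [Function.iterate_succ_apply', Function.iterate_succ_apply', pow_succ']
    refine le_trans ?_ (h.le_map_sub _ _)
    rw [mul_assoc]
    gcongr

theorem iterate_sub_le_succ (h : IsExpandingLift F d c M D) (n : ℕ) (x y : ℝ) :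
    c * |F^[n] x - F^[n] y| ≤ |F^[n + 1] x - F^[n + 1] y| := by
  rw [Function.iterate_succ_apply', Function.iterate_succ_apply']
  exact h.le_map_sub _ _

theorem iterate_succ_sub_le (h : IsExpandingLift F d c M D) (n : ℕ) (x y : ℝ) :
    |F^[n + 1] x - F^[n + 1] y| ≤ M * |F^[n] x - F^[n] y| := by
  rw [Function.iterate_succ_apply', Function.iterate_succ_apply']
  exact h.map_sub_le _ _

theorem monotone_iterate_sub (h : IsExpandingLift F d c M D) (x y : ℝ) :
    Monotone fun n => |F^[n] x - F^[n] y| :=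
  monotone_nat_of_le_succ fun n =>
    (le_mul_of_one_le_left (abs_nonneg _) h.one_lt.le).trans (h.iterate_sub_le_succ n x y)

theorem continuous_iterate (h : IsExpandingLift F d c M D) (n : ℕ) : Continuous F^[n] :=
  h.differentiable.continuous.iterate n

theorem differentiable_iterate (h : IsExpandingLift F d c M D) (n : ℕ) :
    Differentiable ℝ F^[n] :=
  h.differentiable.iterate n

theorem iterate_strictMono_or_strictAnti (h : IsExpandingLift F d c M D) (n : ℕ) :
    StrictMono F^[n] ∨ StrictAnti F^[n] := by
  refine (h.continuous_iterate n).strictMono_of_inj fun x y hxy => ?_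
  have h1 := h.le_iterate_sub n x y
  rw [hxy, sub_self, abs_zero] at h1
  have hc : 0 < c ^ n := pow_pos (one_pos.trans h.one_lt) n
  have : |x - y| ≤ 0 := by
    by_contra! hlt
    exact absurd h1 (not_le.2 (mul_pos hc hlt))
  exact sub_eq_zero.1 (abs_nonpos_iff.1 this)

theorem map_add_int (h : IsExpandingLift F d c M D) (x : ℝ) (m : ℤ) :
    F (x + m) = F x + d * m := by
  have key : ∀ (m : ℕ) (x : ℝ), F (x + m) = F x + d * m := by
    intro m
    induction m with
    | zero => simp
    | succ m ih =>
      intro x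
      rw [Nat.cast_succ, ← add_assoc, h.map_add_one, ih]
      ring
  obtain ⟨k, rfl | rfl⟩ := m.eq_nat_or_neg
  · exact_mod_cast key k x
  · have := key k (x + ((-(k : ℤ) : ℤ) : ℝ))
    push_cast at this ⊢
    rw [neg_add_cancel_right] at this
    linarith

theorem iterate_add_int (h : IsExpandingLift F d c M D) (n : ℕ) (x : ℝ) (m : ℤ) :
    F^[n] (x + m) = F^[n] x + (d : ℝ) ^ n * m := by
  induction n generalizing x m with
  | zero => simp
  | succ n ih =>
    have h1 : F (x + m) = F x + ((d * m : ℤ) : ℝ) := by rw [h.map_add_int]; push_cast; ring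
    rw [Function.iterate_succ_apply, Function.iterate_succ_apply, h1, ih]
    push_cast
    ring

theorem one_lt_abs_degree (h : IsExpandingLift F d c M D) : 1 < |(d : ℝ)| := by
  have := h.le_map_sub (0 + 1) 0
  rw [h.map_add_one] at this
  simp only [zero_add, sub_zero, abs_one, mul_one, add_sub_cancel_left] at this
  exact h.one_lt.trans_le this

theorem abs_iterate_sub_mono (h : IsExpandingLift F d c M D) (n : ℕ) {a x y b : ℝ}
    (hax : a ≤ x) (hxb : x ≤ b) (hay : a ≤ y) (hyb : y ≤ b) :
    |F^[n] x - F^[n] y| ≤ |F^[n] b - F^[n] a| := by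
  rcases h.iterate_strictMono_or_strictAnti n with hm | hm
  · have := hm.monotone hax
    have := hm.monotone hxb
    have := hm.monotone hay
    have := hm.monotone hyb
    rw [abs_le]
    constructor <;> linarith [le_abs_self (F^[n] b - F^[n] a)]
  · have := hm.antitone hax
    have := hm.antitone hxb
    have := hm.antitone hay
    have := hm.antitone hyb
    rw [abs_le]
    constructor <;> linarith [neg_le_abs (F^[n] b - F^[n] a)]

theorem abs_iterate_add_nat_sub (h : IsExpandingLift F d c M D) (n : ℕ) (x : ℝ) (m : ℕ) :
    |F^[n] (x + m) - F^[n] x| = |(d : ℝ)| ^ n * m := by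
  have := h.iterate_add_int n x m
  push_cast at this
  rw [this, add_sub_cancel_left, abs_mul, abs_pow, Nat.abs_cast]

/-- The interval contains one of length 1, whose image has length exactly `|d| ^ n`, and iterates
respect inclusion of intervals. -/
theorem pow_le_abs_iterate_sub (h : IsExpandingLift F d c M D) (n : ℕ) {x y : ℝ}
    (hxy : 1 ≤ |x - y|) : |(d : ℝ)| ^ n ≤ |F^[n] x - F^[n] y| := by
  wlog hlt : y ≤ x generalizing x y
  · rw [abs_sub_comm (F^[n] x)]
    exact this (by rwa [abs_sub_comm]) (le_of_not_ge hlt)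
  rw [abs_of_nonneg (sub_nonneg.2 hlt)] at hxy
  have h1 := h.abs_iterate_add_nat_sub n y 1
  rw [Nat.cast_one, mul_one] at h1
  rw [← h1]
  exact h.abs_iterate_sub_mono n (by linarith) (by linarith) le_rfl hlt

theorem abs_iterate_sub_le_pow (h : IsExpandingLift F d c M D) (n : ℕ) {x y : ℝ} {m : ℕ}
    (hxy : |x - y| ≤ m) : |F^[n] x - F^[n] y| ≤ |(d : ℝ)| ^ n * m := by
  wlog hlt : y ≤ x generalizing x y
  · rw [abs_sub_comm (F^[n] x)]
    exact this (by rwa [abs_sub_comm]) (le_of_not_ge hlt)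
  rw [abs_of_nonneg (sub_nonneg.2 hlt)] at hxy
  rw [← h.abs_iterate_add_nat_sub n y m]
  exact h.abs_iterate_sub_mono n hlt (by linarith) le_rfl (by linarith)

theorem deriv_iterate_succ (h : IsExpandingLift F d c M D) (n : ℕ) (x : ℝ) :
    deriv F^[n + 1] x = deriv F (F^[n] x) * deriv F^[n] x := by
  rw [Function.iterate_succ']
  exact deriv_comp x (h.differentiable _) (h.differentiable_iterate n x)

theorem deriv_iterate_ne_zero (h : IsExpandingLift F d c M D) (n : ℕ) (x : ℝ) :
    deriv F^[n] x ≠ 0 := by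
  induction n with
  | zero => simp
  | succ n ih =>
    rw [h.deriv_iterate_succ]
    refine mul_ne_zero (fun h0 => ?_) ih
    have := h.le_deriv (F^[n] x)
    rw [h0, abs_zero] at this
    linarith [h.one_lt]

theorem log_deriv_iterate_succ (h : IsExpandingLift F d c M D) (n : ℕ) (x : ℝ) :
    Real.log |deriv F^[n + 1] x| = Real.log |deriv F (F^[n] x)| + Real.log |deriv F^[n] x| := by
  have hc := h.one_lt
  rw [h.deriv_iterate_succ, abs_mul, Real.log_mul]
  · linarith [h.le_deriv (F^[n] x)]
  · exact abs_ne_zero.2 (h.deriv_iterate_ne_zero n x)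

theorem log_le_log_deriv (h : IsExpandingLift F d c M D) (x : ℝ) :
    Real.log c ≤ Real.log |deriv F x| :=
  Real.log_le_log (one_pos.trans h.one_lt) (h.le_deriv x)

theorem log_deriv_le_log (h : IsExpandingLift F d c M D) (x : ℝ) :
    Real.log |deriv F x| ≤ Real.log M :=
  Real.log_le_log ((one_pos.trans h.one_lt).trans_le (h.le_deriv x)) (h.deriv_le x)

/-- Bounded distortion. -/
theorem distortion (h : IsExpandingLift F d c M D) (n : ℕ) (x y : ℝ) :
    |Real.log |deriv F^[n] x| - Real.log (|deriv F^[n] y|)|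
      ≤ D / (c - 1) * |F^[n] x - F^[n] y| := by
  have hc : 0 < c - 1 := sub_pos.2 h.one_lt
  have hD := h.D_nonneg
  induction n with
  | zero => simp; positivity
  | succ n ih =>
    rw [h.log_deriv_iterate_succ, h.log_deriv_iterate_succ]
    have h1 := h.log_deriv_lipschitz (F^[n] x) (F^[n] y)
    have h2 := h.iterate_sub_le_succ n x y
    set Δ := |F^[n] x - F^[n] y|
    calc _ ≤ |Real.log |deriv F (F^[n] x)| - Real.log (|deriv F (F^[n] y)|)|
          + |Real.log |deriv F^[n] x| - Real.log (|deriv F^[n] y|)| := by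
            rw [add_sub_add_comm]; exact abs_add_le _ _
      _ ≤ D * Δ + D / (c - 1) * Δ := add_le_add h1 ih
      -- `C = D / (c - 1)` solves `D + C = C * c`: the distortions of earlier steps form a geometric
      -- series dominated by the last image.
      _ = D / (c - 1) * (c * Δ) := by field_simp; ring
      _ ≤ _ := by gcongr

end IsExpandingLift

end Translocal

namespace Translocal

/-! ### Upper and lower limits of real sequences in `EReal` -/

/-- Subadditivity of the upper limit in `EReal` needs no `⊤ + ⊥`; the difference has the finite
limit 0, so no bound on `u` or `v` is required. -/
theorem limsup_le_of_tendsto_sub {u v : ℕ → ℝ} (h : Tendsto (fun n => u n - v n) atTop (𝓝 0)) :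
    limsup (fun n => (u n : EReal)) atTop ≤ limsup (fun n => (v n : EReal)) atTop := by
  have h0 : limsup (fun n => ((u n - v n : ℝ) : EReal)) atTop = 0 :=
    ((continuous_coe_real_ereal.tendsto 0).comp h).limsup_eq
  have he : (fun n => (u n : EReal))
      = (fun n => (v n : EReal)) + fun n => ((u n - v n : ℝ) : EReal) := by
    funext n
    rw [Pi.add_apply, ← EReal.coe_add, add_sub_cancel]
  rw [he]
  refine (EReal.limsup_add_le (Or.inr ?_) (Or.inr ?_)).trans ?_ <;> rw [h0] <;> simp

theorem limsup_eq_of_tendsto_sub {u v : ℕ → ℝ} (h : Tendsto (fun n => u n - v n) atTop (𝓝 0)) :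
    limsup (fun n => (u n : EReal)) atTop = limsup (fun n => (v n : EReal)) atTop :=
  le_antisymm (limsup_le_of_tendsto_sub h)
    (limsup_le_of_tendsto_sub (by simpa using h.neg))

theorem liminf_le_of_tendsto_sub {u v : ℕ → ℝ} (h : Tendsto (fun n => u n - v n) atTop (𝓝 0)) :
    liminf (fun n => (v n : EReal)) atTop ≤ liminf (fun n => (u n : EReal)) atTop := by
  have h0 : liminf (fun n => ((u n - v n : ℝ) : EReal)) atTop = 0 :=
    ((continuous_coe_real_ereal.tendsto 0).comp h).liminf_eq
  have he : (fun n => (u n : EReal))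
      = (fun n => (v n : EReal)) + fun n => ((u n - v n : ℝ) : EReal) := by
    funext n
    rw [Pi.add_apply, ← EReal.coe_add, add_sub_cancel]
  rw [he]
  refine le_trans ?_ EReal.le_liminf_add
  rw [h0, add_zero]

theorem liminf_eq_of_tendsto_sub {u v : ℕ → ℝ} (h : Tendsto (fun n => u n - v n) atTop (𝓝 0)) :
    liminf (fun n => (u n : EReal)) atTop = liminf (fun n => (v n : EReal)) atTop :=
  le_antisymm (liminf_le_of_tendsto_sub (by simpa using h.neg)) (liminf_le_of_tendsto_sub h)

theorem limsup_comp_le {u : ℕ → EReal} {k : ℕ → ℕ} (hk : Tendsto k atTop atTop) :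
    limsup (fun n => u (k n)) atTop ≤ limsup u atTop := by
  have := limsup_comp u k atTop
  rw [show (fun n => u (k n)) = u ∘ k from rfl, this]
  exact limsup_le_limsup_of_le hk

theorem le_liminf_comp {u : ℕ → EReal} {k : ℕ → ℕ} (hk : Tendsto k atTop atTop) :
    liminf u atTop ≤ liminf (fun n => u (k n)) atTop := by
  have := liminf_comp u k atTop
  rw [show (fun n => u (k n)) = u ∘ k from rfl, this]
  exact liminf_le_liminf_of_le hk

/-- A subsequence of a real sequence which comes asymptotically close to every term has the same
upper and lower limits. -/
theorem limsup_liminf_comp_eq {a : ℕ → ℝ} {k m : ℕ → ℕ} (hk : Tendsto k atTop atTop)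
    (hm : Tendsto m atTop atTop)
    (h : Tendsto (fun j => a (k (m j)) - a j) atTop (𝓝 0)) :
    limsup (fun n => (a (k n) : EReal)) atTop = limsup (fun j => (a j : EReal)) atTop ∧
    liminf (fun n => (a (k n) : EReal)) atTop = liminf (fun j => (a j : EReal)) atTop := by
  constructor
  · refine le_antisymm (limsup_comp_le (u := fun j => (a j : EReal)) hk) ?_
    rw [← limsup_eq_of_tendsto_sub h]
    exact limsup_comp_le (u := fun n => (a (k n) : EReal)) hm
  · refine le_antisymm ?_ (le_liminf_comp (u := fun j => (a j : EReal)) hk)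
    rw [← liminf_eq_of_tendsto_sub h]
    exact le_liminf_comp (u := fun n => (a (k n) : EReal)) hm

/-- Monotone continuous maps commute with both limits of a bounded sequence. With `ψ = id` this
passes between limits in `EReal` and in `ℝ`. -/
theorem limsup_liminf_coe_comp {a : ℕ → ℝ} {ψ : ℝ → ℝ} (hmono : Monotone ψ) (hψ : Continuous ψ)
    {α β : ℝ} (h : ∀ᶠ n in atTop, a n ∈ Set.Icc α β) :
    limsup (fun n => (ψ (a n) : EReal)) atTop = (ψ (limsup a atTop) : EReal) ∧
    liminf (fun n => (ψ (a n) : EReal)) atTop = (ψ (liminf a atTop) : EReal) := by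
  have hle : IsBoundedUnder (· ≤ ·) atTop a := isBoundedUnder_of_eventually_le (h.mono fun _ h => h.2)
  have hge : IsBoundedUnder (· ≥ ·) atTop a := isBoundedUnder_of_eventually_ge (h.mono fun _ h => h.1)
  have hm : Monotone fun x => (ψ x : EReal) := fun x y hxy => EReal.coe_le_coe_iff.2 (hmono hxy)
  have hc : Continuous fun x => (ψ x : EReal) := continuous_coe_real_ereal.comp hψ
  exact ⟨(hm.map_limsup_of_continuousAt a hc.continuousAt hle hge.isCoboundedUnder_le).symm,
    (hm.map_liminf_of_continuousAt a hc.continuousAt hle.isCoboundedUnder_ge hge).symm⟩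

/-- If `ℓ` grows at a rate between `α` and `β` and `k n` is, up to a bounded error, the place where
`ℓ` reaches `ω n`, then the upper and lower limits of `(n - k n)⁺ / n` are determined by
those of `ℓ j / j`. -/
theorem limsup_liminf_hitting {ℓ : ℕ → ℝ} {k : ℕ → ℕ} {α β ω A h : ℝ} (hα : 0 < α) (hω : 0 < ω)
    (hh : 0 ≤ h) (hℓ0 : ℓ 0 = 0) (hℓα : ∀ j, ℓ j + α ≤ ℓ (j + 1)) (hℓβ : ∀ j, ℓ (j + 1) ≤ ℓ j + β)
    (hk : ∀ᶠ n : ℕ in atTop, |ℓ (k n) - ω * n| ≤ A) :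
    ∃ lsup linf : ℝ, 0 < lsup ∧ 0 < linf ∧
      limsup (fun j : ℕ => ((ℓ j / j : ℝ) : EReal)) atTop = lsup ∧
      liminf (fun j : ℕ => ((ℓ j / j : ℝ) : EReal)) atTop = linf ∧
      limsup (fun n : ℕ => ((((n - k n : ℕ) : ℝ) * h / n : ℝ) : EReal)) atTop
        = (max (1 - ω / lsup) 0 * h : ℝ) ∧
      liminf (fun n : ℕ => ((((n - k n : ℕ) : ℝ) * h / n : ℝ) : EReal)) atTop
        = (max (1 - ω / linf) 0 * h : ℝ) := by
  have hβ : 0 < β := by linarith [hℓα 0, hℓβ 0]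
  have hA : 0 ≤ A := by
    obtain ⟨n, hn⟩ := hk.exists
    exact (abs_nonneg _).trans hn
  have hup : ∀ i j, i ≤ j → ℓ i + α * (j - i) ≤ ℓ j := by
    intro i j hij
    induction j, hij using Nat.le_induction with
    | base => simp
    | succ j hij ih => push_cast; linarith [hℓα j]
  have hub : ∀ j : ℕ, ℓ j ≤ β * j := by
    intro j
    induction j with
    | zero => simp [hℓ0]
    | succ j ih => push_cast; linarith [hℓβ j]
  have hlb : ∀ j : ℕ, α * j ≤ ℓ j := fun j => by simpa [hℓ0] using hup 0 j (Nat.zero_le j)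
  have hdiff : ∀ i j : ℕ, α * |(i : ℝ) - j| ≤ |ℓ i - ℓ j| := by
    intro i j
    rcases le_total i j with hij | hij
    · rw [abs_sub_comm, abs_sub_comm (ℓ i), abs_of_nonneg (sub_nonneg.2 (by exact_mod_cast hij))]
      linarith [hup i j hij, le_abs_self (ℓ j - ℓ i)]
    · rw [abs_of_nonneg (sub_nonneg.2 (by exact_mod_cast hij))]
      linarith [hup j i hij, le_abs_self (ℓ i - ℓ j)]
  have hnat : Tendsto (fun n : ℕ => (n : ℝ)) atTop atTop := tendsto_natCast_atTop_atTop
  have hktop : Tendsto k atTop atTop := by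
    refine tendsto_natCast_atTop_iff (R := ℝ).1 ?_
    have h1 : Tendsto (fun n : ℕ => (ω * n - A) / β) atTop atTop :=
      ((tendsto_atTop_add_const_right _ _ (hnat.const_mul_atTop hω))).atTop_div_const hβ
    refine tendsto_atTop_mono' _ ?_ h1
    filter_upwards [hk] with n hn
    rw [div_le_iff₀ hβ]
    linarith [(abs_le.1 hn).1, hub (k n)]
  -- For this `n = m j`, `ω n` is within `ω` of `ℓ j`. Hence `ℓ (k n)` is within `A + ω` of `ℓ j`
  -- and, by growth at rate at least `α`, `k n` is within `(A + ω) / α` of `j`.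
  set m : ℕ → ℕ := fun j => ⌊ℓ j / ω⌋₊ with hm
  have hmtop : Tendsto m atTop atTop := by
    refine tendsto_nat_floor_atTop.comp ((tendsto_atTop_mono hlb ?_).atTop_div_const hω)
    exact hnat.const_mul_atTop hα
  have hclose : Tendsto (fun j => ℓ (k (m j)) / (k (m j) : ℝ) - ℓ j / j) atTop (𝓝 0) := by
    have hkm := hktop.comp hmtop
    have hinv : Tendsto (fun j => ((A + ω) + β * ((A + ω) / α)) / (k (m j) : ℝ)) atTop (𝓝 0) :=
      (hnat.comp hkm).const_div_atTop _
    refine squeeze_zero_norm' ?_ hinv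
    filter_upwards [hmtop.eventually hk, hkm.eventually_gt_atTop 0, eventually_gt_atTop 0]
      with j h1 h2 h3
    have h2' : (0 : ℝ) < k (m j) := by exact_mod_cast h2
    have h3' : (0 : ℝ) < j := by exact_mod_cast h3
    have hℓj : 0 ≤ ℓ j := le_trans (by positivity) (hlb j)
    have hfl : |ω * m j - ℓ j| ≤ ω := by
      have e1 := Nat.floor_le (div_nonneg hℓj hω.le)
      have e2 := Nat.lt_floor_add_one (ℓ j / ω)
      rw [le_div_iff₀ hω] at e1
      rw [div_lt_iff₀ hω] at e2
      simp only [hm]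
      rw [abs_le]
      constructor <;> nlinarith
    have hd : |ℓ (k (m j)) - ℓ j| ≤ A + ω := by
      have := abs_add_le (ℓ (k (m j)) - ω * m j) (ω * m j - ℓ j)
      rw [sub_add_sub_cancel] at this
      linarith
    have hd2 : |(k (m j) : ℝ) - j| ≤ (A + ω) / α := by
      rw [le_div_iff₀ hα]
      linarith [hdiff (k (m j)) j]
    have hid : ℓ (k (m j)) / (k (m j) : ℝ) - ℓ j / j
        = ((ℓ (k (m j)) - ℓ j) - ℓ j / j * (k (m j) - j)) / k (m j) := by
      field_simp
      ring
    rw [hid, Real.norm_eq_abs, abs_div, abs_of_pos h2']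
    gcongr
    refine (abs_sub _ _).trans (add_le_add hd ?_)
    rw [abs_mul]
    gcongr
    rw [abs_of_nonneg (by positivity), div_le_iff₀ h3']
    exact hub j
  obtain ⟨hs, hi⟩ := limsup_liminf_comp_eq (a := fun j : ℕ => ℓ j / j) hktop hmtop hclose
  have hIcc : ∀ᶠ j : ℕ in atTop, ℓ j / j ∈ Set.Icc α β := by
    filter_upwards [eventually_gt_atTop 0] with j hj
    have hj' : (0 : ℝ) < j := by exact_mod_cast hj
    exact ⟨(le_div_iff₀ hj').2 (hlb j), (div_le_iff₀ hj').2 (hub j)⟩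
  have hIcck := hktop.eventually hIcc
  obtain ⟨hs1, hi1⟩ := limsup_liminf_coe_comp (ψ := id) monotone_id continuous_id hIcc
  obtain ⟨hs2, hi2⟩ := limsup_liminf_coe_comp (ψ := id) monotone_id continuous_id hIcck
  -- Cutting off at `α` makes `ψ` continuous and monotone on all of `ℝ`; the quotients `ℓ j / j`
  -- with `j > 0` are at least `α`, so nothing changes there.
  set ψ : ℝ → ℝ := fun x => max (1 - ω / max x α) 0 * h with hψ
  have hψmono : Monotone ψ := by
    intro x y hxy
    have : 0 < max x α := lt_max_of_lt_right hα
    simp only [hψ]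
    gcongr
  have hψcont : Continuous ψ := by
    have : ∀ x : ℝ, max x α ≠ 0 := fun x => (lt_max_of_lt_right hα).ne'
    simp only [hψ]
    fun_prop (disch := exact this _)
  obtain ⟨hs3, hi3⟩ := limsup_liminf_coe_comp hψmono hψcont hIcck
  have hkey : Tendsto (fun n : ℕ => ((n - k n : ℕ) : ℝ) * h / n - ψ (ℓ (k n) / k n)) atTop
      (𝓝 0) := by
    have hinv : Tendsto (fun n : ℕ => (A / α * h) / (n : ℝ)) atTop (𝓝 0) :=
      hnat.const_div_atTop _
    refine squeeze_zero_norm' ?_ hinv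
    filter_upwards [hk, hktop.eventually_gt_atTop 0, eventually_gt_atTop 0, hIcck]
      with n h1 h2 h3 h4
    have h2' : (0 : ℝ) < k n := by exact_mod_cast h2
    have h3' : (0 : ℝ) < n := by exact_mod_cast h3
    have hℓ : 0 < ℓ (k n) := lt_of_lt_of_le (by positivity) (hlb (k n))
    have e1 : ((n - k n : ℕ) : ℝ) * h / n = max (1 - (k n : ℝ) / n) 0 * h := by
      have : ((n - k n : ℕ) : ℝ) = max ((n : ℝ) - k n) 0 := by
        rcases le_total (k n) n with hle | hle
        · rw [Nat.cast_sub hle, max_eq_left (sub_nonneg.2 (by exact_mod_cast hle))]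
        · rw [Nat.sub_eq_zero_of_le hle, max_eq_right (sub_nonpos.2 (by exact_mod_cast hle))]
          simp
      rw [this, mul_div_right_comm, ← max_div_div_right h3'.le, zero_div, sub_div,
        div_self h3'.ne']
    have e2 : ψ (ℓ (k n) / k n) = max (1 - ω / (ℓ (k n) / k n)) 0 * h := by
      simp only [hψ]
      rw [max_eq_left h4.1]
    rw [e1, e2, ← sub_mul, Real.norm_eq_abs, abs_mul, abs_of_nonneg hh, mul_div_right_comm]
    gcongr
    refine (abs_max_sub_max_le_abs _ _ _).trans ?_
    have e3 : 1 - (k n : ℝ) / n - (1 - ω / (ℓ (k n) / k n))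
        = -((ℓ (k n) - ω * n) * (k n / ℓ (k n))) / n := by
      field_simp
      ring
    rw [e3, abs_div, abs_neg, abs_of_pos h3', abs_mul]
    gcongr
    rw [div_eq_mul_inv A]
    gcongr
    rw [abs_of_pos (by positivity), div_le_iff₀ hℓ, inv_mul_eq_div, le_div_iff₀ hα]
    linarith [hlb (k n)]
  have hbound : ∀ {a : ℕ → ℝ}, (∀ᶠ n in atTop, a n ∈ Set.Icc α β) →
      α ≤ limsup a atTop ∧ α ≤ liminf a atTop := by
    intro a ha
    have hle : IsBoundedUnder (· ≤ ·) atTop a :=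
      isBoundedUnder_of_eventually_le (ha.mono fun _ h => h.2)
    have hge : IsBoundedUnder (· ≥ ·) atTop a :=
      isBoundedUnder_of_eventually_ge (ha.mono fun _ h => h.1)
    have h1 : α ≤ liminf a atTop :=
      le_liminf_of_le hle.isCoboundedUnder_ge (ha.mono fun _ h => h.1)
    exact ⟨h1.trans (liminf_le_limsup hle hge), h1⟩
  obtain ⟨b1, b2⟩ := hbound hIcc
  simp only [id] at hs1 hi1 hs2 hi2
  have es : limsup (fun n => ℓ (k n) / (k n : ℝ)) atTop
      = limsup (fun j : ℕ => ℓ j / (j : ℝ)) atTop :=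
    EReal.coe_injective (by rw [← hs1, ← hs2]; exact hs)
  have ei : liminf (fun n => ℓ (k n) / (k n : ℝ)) atTop
      = liminf (fun j : ℕ => ℓ j / (j : ℝ)) atTop :=
    EReal.coe_injective (by rw [← hi1, ← hi2]; exact hi)
  refine ⟨_, _, hα.trans_le b1, hα.trans_le b2, hs1, hi1, ?_, ?_⟩
  · rw [limsup_eq_of_tendsto_sub hkey, hs3, es]
    simp only [hψ]
    rw [max_eq_left b1]
  · rw [liminf_eq_of_tendsto_sub hkey, hi3, ei]
    simp only [hψ]
    rw [max_eq_left b2]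

end Translocal

namespace Translocal

/-! ### Counting separated points -/

theorem dist_coe_of_abs_sub_le {x y : ℝ} (h : |x - y| ≤ 1 / 2) :
    dist (x : UnitAddCircle) (y : UnitAddCircle) = |x - y| := by
  rw [dist_eq_norm, ← AddCircle.coe_sub]
  exact (AddCircle.norm_coe_eq_abs_iff 1 one_ne_zero).2 (by simpa using h)

theorem dist_coe_le (x y : ℝ) : dist (x : UnitAddCircle) (y : UnitAddCircle) ≤ |x - y| := by
  rw [dist_eq_norm, ← AddCircle.coe_sub, UnitAddCircle.norm_eq]
  simpa using round_le (x - y) 0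

theorem closedBall_coe_subset (x r : ℝ) :
    Metric.closedBall (x : UnitAddCircle) r
      ⊆ ((↑) : ℝ → UnitAddCircle) '' Set.Icc (x - r) (x + r) := by
  intro w hw
  obtain ⟨y, rfl⟩ := QuotientAddGroup.mk_surjective w
  have hw' : ‖((y - x : ℝ) : UnitAddCircle)‖ ≤ r := by
    rw [AddCircle.coe_sub, ← dist_eq_norm]
    exact hw
  rw [UnitAddCircle.norm_eq, abs_le] at hw'
  refine ⟨y + ((-round (y - x) : ℤ) : ℝ), ?_, coe_add_int y _⟩
  push_cast
  constructor <;> linarith [hw'.1, hw'.2]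

theorem image_Icc_subset_closure_ball (x : ℝ) {r : ℝ} (hr : 0 < r) :
    ((↑) : ℝ → UnitAddCircle) '' Set.Icc (x - r) (x + r)
      ⊆ closure (Metric.ball (x : UnitAddCircle) r) := by
  rw [← closure_Ioo (by linarith : x - r ≠ x + r)]
  refine (image_closure_subset_closure_image (AddCircle.continuous_mk' 1)).trans
    (closure_mono ?_)
  rintro _ ⟨y, hy, rfl⟩
  refine (dist_coe_le y x).trans_lt (abs_lt.2 ?_)
  constructor <;> linarith [hy.1, hy.2]

/-- Finite positive bounds exclude the values `⊤` and `⊥` of the extended logarithm. -/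
theorem exists_sepRate_eq {X : Type*} [PseudoMetricSpace X] {f : X → X} {n : ℕ} {ε : ℝ}
    {K : Set X} {m N : ℕ} (hm : (m : ℕ∞) ≤ maxSep f n ε K) (hm1 : 1 ≤ m)
    (hN : maxSep f n ε K ≤ N) :
    ∃ s : ℕ, m ≤ s ∧ s ≤ N ∧ sepRate f n ε K = ((Real.log s / n : ℝ) : EReal) := by
  obtain ⟨s, hs⟩ := ENat.ne_top_iff_exists.1 (ne_top_of_le_ne_top (ENat.natCast_ne_top N) hN)
  rw [← hs, Nat.cast_le] at hm hN
  refine ⟨s, hm, hN, ?_⟩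
  unfold sepRate
  have h0 : (s : ℝ≥0∞) ≠ 0 := by exact_mod_cast (Nat.pos_of_ne_zero (by omega : s ≠ 0)).ne'
  rw [← hs, EReal.coe_div, ENat.toENNReal_coe,
    ENNReal.log_pos_real h0 (ENNReal.natCast_ne_top s), ENNReal.toReal_natCast]
  rfl

namespace IsExpandingLift

variable {F : ℝ → ℝ} {d : ℤ} {c M D : ℝ} {f : UnitAddCircle → UnitAddCircle}

/-- Replacing `F^[n]` by its negative when it reverses orientation spares the counting arguments a
case distinction. -/
theorem exists_monotone_abs_sub_eq (h : IsExpandingLift F d c M D) (n : ℕ) :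
    ∃ g : ℝ → ℝ, Monotone g ∧ ∀ x y, |g x - g y| = |F^[n] x - F^[n] y| := by
  rcases h.iterate_strictMono_or_strictAnti n with hm | hm
  · exact ⟨_, hm.monotone, fun _ _ => rfl⟩
  · refine ⟨fun x => -F^[n] x, hm.antitone.neg, fun x y => ?_⟩
    rw [← abs_neg]
    congr 1
    ring

/-- Pigeonhole: cut the image interval into cells of length `ε`. Two points in one cell are less
than `ε` apart at time `n`, hence at all earlier times by expansion, so they are not separated. -/
theorem maxSep_le (h : IsExpandingLift F d c M D)
    (hf : ∀ x : ℝ, f (x : UnitAddCircle) = (F x : UnitAddCircle)) {K : Set UnitAddCircle}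
    {a b : ℝ} (hK : K ⊆ ((↑) : ℝ → UnitAddCircle) '' Set.Icc a b) {ε : ℝ} (hε : 0 < ε) (n : ℕ) :
    maxSep f n ε K ≤ (⌊|F^[n] b - F^[n] a| / ε⌋₊ + 1 : ℕ) := by
  refine iSup₂_le fun E hE => ?_
  rw [Nat.cast_le]
  have hlift : ∀ e : UnitAddCircle, ∃ x : ℝ, e ∈ E → x ∈ Set.Icc a b ∧ (x : UnitAddCircle) = e := by
    intro e
    by_cases he : e ∈ E
    · obtain ⟨x, hx, hxe⟩ := hK (hE.1 he)
      exact ⟨x, fun _ => ⟨hx, hxe⟩⟩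
    · exact ⟨0, fun h => absurd h he⟩
  choose p hp using hlift
  obtain ⟨g, hg, hgF⟩ := h.exists_monotone_abs_sub_eq n
  rw [← hgF, ← Finset.card_range (_ + 1)]
  refine Finset.card_le_card_of_injOn (fun e => ⌊(g (p e) - g a) / ε⌋₊) ?_ ?_
  · intro e he
    have hpe := (hp e he).1
    rw [Finset.coe_range, Set.mem_Iio, Nat.lt_succ_iff]
    refine Nat.floor_le_floor ?_
    gcongr
    exact le_trans (by linarith [hg hpe.2]) (le_abs_self _)
  · intro e he e' he' hee
    by_contra hne
    obtain ⟨hpe, hce⟩ := hp e he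
    obtain ⟨hpe', hce'⟩ := hp e' he'
    obtain ⟨j, hj, hd⟩ := hE.2 e he e' he' hne
    have h0 : 0 ≤ (g (p e) - g a) / ε := div_nonneg (by linarith [hg hpe.1]) hε.le
    have h0' : 0 ≤ (g (p e') - g a) / ε := div_nonneg (by linarith [hg hpe'.1]) hε.le
    have hfl : ⌊(g (p e) - g a) / ε⌋ = ⌊(g (p e') - g a) / ε⌋ := by
      rw [← Int.natCast_floor_eq_floor h0, ← Int.natCast_floor_eq_floor h0']
      exact congrArg _ hee
    have hlt := Int.abs_sub_lt_one_of_floor_eq_floor hfl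
    rw [← sub_div, sub_sub_sub_cancel_right, abs_div, abs_of_pos hε, div_lt_one hε, hgF] at hlt
    rw [← hce, ← hce', iterate_coe hf, iterate_coe hf] at hd
    have := h.monotone_iterate_sub (p e) (p e') hj.le
    linarith [dist_coe_le (F^[j] (p e)) (F^[j] (p e'))]

/-- If lifts are less than `ε` apart, their next images are at most `M * ε ≤ 1 / 2` apart, where
circle distance equals distance on the line; closeness thus lifts inductively, without wrapping. -/
theorem abs_iterate_sub_lt (h : IsExpandingLift F d c M D)
    (hf : ∀ x : ℝ, f (x : UnitAddCircle) = (F x : UnitAddCircle)) {ε : ℝ} (hMε : M * ε ≤ 1 / 2)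
    {x y : ℝ} (hxy : |x - y| ≤ 1 / 2) {n : ℕ}
    (hd : ∀ j < n + 1, dist (f^[j] (x : UnitAddCircle)) (f^[j] (y : UnitAddCircle)) < ε) :
    |F^[n] x - F^[n] y| < ε := by
  have hM := h.M_gt_one
  induction n with
  | zero => simpa [dist_coe_of_abs_sub_le hxy] using hd 0 one_pos
  | succ n ih =>
    have h1 := ih fun j hj => hd j (by omega)
    have h2 : |F^[n + 1] x - F^[n + 1] y| ≤ 1 / 2 :=
      (h.iterate_succ_sub_le n x y).trans (le_trans (by gcongr) hMε)
    have h3 := hd (n + 1) (by omega)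
    rwa [iterate_coe hf, iterate_coe hf, dist_coe_of_abs_sub_le h2] at h3

/-- Take preimages under `F^[n]` of points spaced `ε` apart. Separation time `n + 1` is needed for
the Bowen metric to see time `n`; width at most `1 / 2` starts the no-wrapping induction. -/
theorem le_maxSep (h : IsExpandingLift F d c M D)
    (hf : ∀ x : ℝ, f (x : UnitAddCircle) = (F x : UnitAddCircle)) {K : Set UnitAddCircle}
    {a b : ℝ} (hab : a ≤ b) (hab' : b - a ≤ 1 / 2)
    (hK : ((↑) : ℝ → UnitAddCircle) '' Set.Icc a b ⊆ K) {ε : ℝ} (hε : 0 < ε)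
    (hMε : M * ε ≤ 1 / 2) (n : ℕ) :
    ((⌊|F^[n] b - F^[n] a| / ε⌋₊ + 1 : ℕ) : ℕ∞) ≤ maxSep f (n + 1) ε K := by
  classical
  obtain ⟨g, hg, hgF⟩ := h.exists_monotone_abs_sub_eq n
  have hgc : Continuous g := by
    refine continuous_iff_continuousAt.2 fun x => tendsto_iff_dist_tendsto_zero.2 ?_
    have := tendsto_iff_dist_tendsto_zero.1 ((h.continuous_iterate n).tendsto x)
    simpa only [Real.dist_eq, hgF] using this
  rw [← hgF, abs_of_nonneg (sub_nonneg.2 (hg hab))]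
  set N := ⌊(g b - g a) / ε⌋₊ with hN
  have hNε : N * ε ≤ g b - g a := by
    rw [← le_div_iff₀ hε]
    exact Nat.floor_le (div_nonneg (sub_nonneg.2 (hg hab)) hε.le)
  have hex : ∀ i : ℕ, ∃ x : ℝ, i ≤ N → x ∈ Set.Icc a b ∧ g x = g a + i * ε := by
    intro i
    by_cases hi : i ≤ N
    · have hi' : (i : ℝ) * ε ≤ N * ε := by gcongr
      obtain ⟨x, hx, hgx⟩ := intermediate_value_Icc hab hgc.continuousOn
        (show g a + i * ε ∈ Set.Icc (g a) (g b) from ⟨by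
          have : 0 ≤ (i : ℝ) * ε := by positivity
          linarith, by linarith⟩)
      exact ⟨x, fun _ => ⟨hx, hgx⟩⟩
    · exact ⟨0, fun h => absurd h hi⟩
  choose p hp using hex
  have hsep : ∀ i ≤ N, ∀ j ≤ N, i ≠ j → ∃ l < n + 1,
      ε ≤ dist (f^[l] (p i : UnitAddCircle)) (f^[l] (p j : UnitAddCircle)) := by
    intro i hi j hj hij
    by_contra! hcon
    obtain ⟨hpi, hgi⟩ := hp i hi
    obtain ⟨hpj, hgj⟩ := hp j hj
    have hclose : |p i - p j| ≤ 1 / 2 := by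
      rw [abs_le]
      constructor <;> linarith [hpi.1, hpi.2, hpj.1, hpj.2]
    have hlt := h.abs_iterate_sub_lt hf hMε hclose hcon
    rw [← hgF, hgi, hgj, add_sub_add_left_eq_sub, ← sub_mul, abs_mul, abs_of_pos hε] at hlt
    have h1 : (1 : ℝ) ≤ |(i : ℝ) - j| := by
      have : (1 : ℤ) ≤ |(i : ℤ) - j| := Int.one_le_abs (sub_ne_zero.2 (by exact_mod_cast hij))
      exact_mod_cast this
    nlinarith
  set E : Finset UnitAddCircle := (Finset.range (N + 1)).image fun i => (p i : UnitAddCircle)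
  have hcard : E.card = N + 1 := by
    rw [Finset.card_image_of_injOn, Finset.card_range]
    intro i hi j hj hij
    by_contra hne
    simp only [Finset.coe_range, Set.mem_Iio, Nat.lt_succ_iff] at hi hj
    obtain ⟨l, -, hl⟩ := hsep i hi j hj hne
    simp only at hij
    rw [hij, dist_self] at hl
    linarith
  rw [← hcard]
  refine le_iSup₂_of_le E ⟨?_, ?_⟩ le_rfl
  · intro e he
    obtain ⟨i, hi, rfl⟩ := Finset.mem_image.1 (Finset.mem_coe.1 he)
    exact hK ⟨p i, (hp i (Nat.lt_succ_iff.1 (Finset.mem_range.1 hi))).1, rfl⟩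
  · intro e he e' he' hne
    obtain ⟨i, hi, rfl⟩ := Finset.mem_image.1 (Finset.mem_coe.1 he)
    obtain ⟨j, hj, rfl⟩ := Finset.mem_image.1 (Finset.mem_coe.1 he')
    exact hsep i (Nat.lt_succ_iff.1 (Finset.mem_range.1 hi)) j
      (Nat.lt_succ_iff.1 (Finset.mem_range.1 hj)) fun hij => hne (by rw [hij])

/-- If `exp (w n)` is, up to a bounded factor, the length of the `n`-th image of an interval
whose projection is contained in `K n`, and of one whose projection contains `K n`, then the
exponential growth rate of the separated subsets of `K n` is that of `exp (w n)`. -/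
theorem upperRate_lowerRate_eq (h : IsExpandingLift F d c M D)
    (hf : ∀ x : ℝ, f (x : UnitAddCircle) = (F x : UnitAddCircle)) {K : ℕ → Set UnitAddCircle}
    {x A : ℝ} {ρ r w : ℕ → ℝ}
    (hρ : ∀ᶠ n in atTop, 0 ≤ ρ n ∧ ρ n ≤ 1 / 4)
    (hρK : ∀ᶠ n in atTop, ((↑) : ℝ → UnitAddCircle) '' Set.Icc (x - ρ n) (x + ρ n) ⊆ K n)
    (hKr : ∀ᶠ n in atTop, K n ⊆ ((↑) : ℝ → UnitAddCircle) '' Set.Icc (x - r n) (x + r n))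
    (hw : ∀ᶠ n in atTop, w n - A ≤ Real.log (1 + |F^[n] (x + ρ n) - F^[n] (x - ρ n)|))
    (hw' : ∀ᶠ n in atTop, Real.log (1 + |F^[n] (x + r n) - F^[n] (x - r n)|) ≤ w n + A) :
    upperRate f K = limsup (fun n : ℕ => ((w n / n : ℝ) : EReal)) atTop ∧
    lowerRate f K = liminf (fun n : ℕ => ((w n / n : ℝ) : EReal)) atTop := by
  have hM := h.M_gt_one
  -- For each fixed small `ε` the rate is already within `O(1 / n)` of `w n / n`, so its limits do
  -- not depend on `ε`.
  have key : ∀ ε : ℝ, 0 < ε → ε ≤ 1 → M * ε ≤ 1 / 2 → ∃ σ : ℕ → ℝ,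
      (∀ᶠ n in atTop, sepRate f n ε (K n) = (σ n : EReal)) ∧
      Tendsto (fun n => σ n - w n / n) atTop (𝓝 0) := by
    intro ε hε hε1 hMε
    have hall : ∀ᶠ n : ℕ in atTop, ∃ s : ℝ, sepRate f n ε (K n) = (s : EReal) ∧
        |s - w n / n| ≤ (A + Real.log (2 * M) - Real.log ε) / n := by
      filter_upwards [hρ, hρK, hKr, hw, hw', eventually_gt_atTop 0]
        with n h1 h2 h3 h4 h5 hn
      obtain ⟨k, rfl⟩ := Nat.exists_eq_succ_of_ne_zero hn.ne'
      have hlow := h.le_maxSep hf (by linarith) (by linarith) h2 hε hMε k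
      have hup := h.maxSep_le hf h3 hε (k + 1)
      obtain ⟨s, hs1, hs2, hs⟩ := exists_sepRate_eq hlow (Nat.le_add_left 1 _) hup
      refine ⟨_, hs, ?_⟩
      have hn' : (0 : ℝ) < (k + 1 : ℕ) := by positivity
      rw [← sub_div, abs_div, abs_of_pos hn']
      gcongr
      have hs0 : (1 : ℝ) ≤ s := by exact_mod_cast (Nat.le_add_left 1 _).trans hs1
      have hlogε : Real.log ε ≤ 0 := Real.log_nonpos hε.le hε1
      have hlogM : 0 ≤ Real.log (2 * M) := Real.log_nonneg (by linarith)
      have hLs : |F^[k] (x + ρ (k + 1)) - F^[k] (x - ρ (k + 1))| ≤ s := by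
        refine (le_div_self (abs_nonneg _) hε hε1).trans
          ((Nat.lt_floor_add_one _).le.trans ?_)
        exact_mod_cast hs1
      -- The lower count sees only the `k`-th image; one more iterate costs at most a factor `M`,
      -- whence `log (2 * M)`.
      have hA : Real.log (1 + |F^[k + 1] (x + ρ (k + 1)) - F^[k + 1] (x - ρ (k + 1))|)
          ≤ Real.log (2 * M) + Real.log s := by
        rw [← Real.log_mul (by positivity) (by positivity)]
        refine Real.log_le_log (by positivity) ?_
        have e1 := h.iterate_succ_sub_le k (x + ρ (k + 1)) (x - ρ (k + 1))
        have e2 := mul_le_mul_of_nonneg_left hLs (zero_le_one.trans hM.le)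
        have e3 : 1 * 1 ≤ M * s := mul_le_mul hM.le hs0 zero_le_one (by positivity)
        linarith
      have hB : Real.log s
          ≤ Real.log (1 + |F^[k + 1] (x + r (k + 1)) - F^[k + 1] (x - r (k + 1))|)
            - Real.log ε := by
        rw [← Real.log_div (by positivity) hε.ne']
        refine Real.log_le_log (by positivity) ?_
        have e1 : (s : ℝ) ≤ ⌊|F^[k + 1] (x + r (k + 1)) - F^[k + 1] (x - r (k + 1))| / ε⌋₊ + 1 := by
          exact_mod_cast hs2
        have e2 : (⌊|F^[k + 1] (x + r (k + 1)) - F^[k + 1] (x - r (k + 1))| / ε⌋₊ : ℝ)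
            ≤ |F^[k + 1] (x + r (k + 1)) - F^[k + 1] (x - r (k + 1))| / ε :=
          Nat.floor_le (by positivity)
        have e3 : 1 ≤ 1 / ε := (one_le_div hε).2 hε1
        rw [add_div]
        linarith
      simp only [Nat.succ_eq_add_one] at h4 h5 ⊢
      rw [abs_le]
      constructor <;> linarith
    have hall' : ∀ n, ∃ s : ℝ, (∃ s : ℝ, sepRate f n ε (K n) = (s : EReal) ∧
        |s - w n / n| ≤ (A + Real.log (2 * M) - Real.log ε) / n) →
        sepRate f n ε (K n) = (s : EReal) ∧
        |s - w n / n| ≤ (A + Real.log (2 * M) - Real.log ε) / n := by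
      intro n
      by_cases hn : ∃ s : ℝ, sepRate f n ε (K n) = (s : EReal) ∧
        |s - w n / n| ≤ (A + Real.log (2 * M) - Real.log ε) / n
      · exact ⟨hn.choose, fun _ => hn.choose_spec⟩
      · exact ⟨0, fun h => absurd h hn⟩
    choose σ hσ using hall'
    have hσ' := hall.mono fun n hn => hσ n hn
    exact ⟨σ, hσ'.mono fun n hn => hn.1, squeeze_zero_norm' (hσ'.mono fun n hn => hn.2)
      (tendsto_natCast_atTop_atTop.const_div_atTop _)⟩
  have hsmall : ∀ᶠ ε : ℝ in 𝓝[>] 0, 0 < ε ∧ ε ≤ 1 ∧ M * ε ≤ 1 / 2 := by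
    have hpos : 0 < min 1 (1 / 2 / M) := by positivity
    filter_upwards [Ioc_mem_nhdsGT hpos] with ε hε
    have e2 := hε.2.trans (min_le_right _ _)
    rw [le_div_iff₀ (by positivity)] at e2
    exact ⟨hε.1, hε.2.trans (min_le_left _ _), by linarith⟩
  constructor
  · refine tendsto_nhds_unique (tendsto_upperRate f K) (tendsto_nhds_of_eventually_eq ?_)
    filter_upwards [hsmall] with ε hε
    obtain ⟨σ, h1, h2⟩ := key ε hε.1 hε.2.1 hε.2.2
    rw [limsup_congr h1, limsup_eq_of_tendsto_sub h2]
  · refine tendsto_nhds_unique (tendsto_lowerRate f K) (tendsto_nhds_of_eventually_eq ?_)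
    filter_upwards [hsmall] with ε hε
    obtain ⟨σ, h1, h2⟩ := key ε hε.1 hε.2.1 hε.2.2
    rw [liminf_congr h1, liminf_eq_of_tendsto_sub h2]

end IsExpandingLift

end Translocal

namespace Translocal

namespace IsExpandingLift

variable {F : ℝ → ℝ} {d : ℤ} {c M D : ℝ} {f : UnitAddCircle → UnitAddCircle}

/-! ### Growth of short intervals -/

/-- A short interval grows to macroscopic size at some time `k`, after which its length grows
like the powers of the degree. -/
theorem exists_hitting_time (h : IsExpandingLift F d c M D) {a b : ℝ} (hab : a < b)
    (hab' : b - a < 1) : ∃ k : ℕ, 1 ≤ |F^[k] b - F^[k] a| ∧ |F^[k] b - F^[k] a| ≤ M ∧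
      ∀ n, |(d : ℝ)| ^ (n - k) ≤ 1 + |F^[n] b - F^[n] a| ∧
        1 + |F^[n] b - F^[n] a| ≤ (1 + ⌈M⌉₊) * |(d : ℝ)| ^ (n - k) := by
  classical
  have hM := h.M_gt_one
  have hd := h.one_lt_abs_degree
  have hM1 : (1 : ℝ) ≤ ⌈M⌉₊ := hM.le.trans (Nat.le_ceil M)
  have hex : ∃ k, 1 ≤ |F^[k] b - F^[k] a| := by
    obtain ⟨k, hk⟩ := pow_unbounded_of_one_lt (1 / (b - a)) h.one_lt
    refine ⟨k, le_trans ?_ (h.le_iterate_sub k b a)⟩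
    rw [div_lt_iff₀ (sub_pos.2 hab)] at hk
    rw [abs_of_pos (sub_pos.2 hab)]
    exact hk.le
  -- By minimality of the hitting time; one further step multiplies the length by at most `M`, which
  -- bounds it at time `k`.
  have hlt : ∀ j < Nat.find hex, |F^[j] b - F^[j] a| < 1 := fun j hj =>
    not_le.1 (Nat.find_min hex hj)
  have hspec := Nat.find_spec hex
  set k := Nat.find hex
  have hkM : |F^[k] b - F^[k] a| ≤ M := by
    rcases Nat.eq_zero_or_pos k with hk | hk
    · rw [hk] at hspec
      simp only [Function.iterate_zero, id, abs_of_pos (sub_pos.2 hab)] at hspec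
      linarith
    · obtain ⟨j, hj⟩ := Nat.exists_eq_succ_of_ne_zero hk.ne'
      rw [hj]
      refine (h.iterate_succ_sub_le j b a).trans ?_
      have := hlt j (by omega)
      nlinarith
  refine ⟨k, hspec, hkM, fun n => ?_⟩
  rcases le_total k n with hkn | hkn
  · obtain ⟨m, rfl⟩ := Nat.exists_eq_add_of_le' hkn
    rw [Nat.add_sub_cancel, Function.iterate_add_apply, Function.iterate_add_apply]
    have h1 := h.pow_le_abs_iterate_sub m hspec
    have h2 := h.abs_iterate_sub_le_pow m (hkM.trans (Nat.le_ceil M))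
    have h3 : 1 ≤ |(d : ℝ)| ^ m := one_le_pow₀ hd.le
    constructor <;> linarith
  -- Up to time `k`, truncated subtraction makes the power 1, and the added 1 keeps both bounds
  -- valid for tiny lengths.
  · rw [Nat.sub_eq_zero_of_le hkn, pow_zero, mul_one]
    refine ⟨by linarith [abs_nonneg (F^[n] b - F^[n] a)], ?_⟩
    rcases hkn.eq_or_lt with rfl | hlt'
    · linarith [Nat.le_ceil M]
    · linarith [hlt n hlt']

/-- At the time when the interval of radius `r` around `x` has macroscopic size, the derivative
of the iterate is of the order of `1 / r`. -/
theorem abs_log_deriv_add_log_le (h : IsExpandingLift F d c M D) {x r : ℝ} (hr : 0 < r) {k : ℕ}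
    (h1 : 1 ≤ |F^[k] (x + r) - F^[k] (x - r)|) (hM : |F^[k] (x + r) - F^[k] (x - r)| ≤ M) :
    |Real.log |deriv F^[k] x| + Real.log r| ≤ D / (c - 1) * M + Real.log M + Real.log 2 := by
  have hc : 0 < c - 1 := sub_pos.2 h.one_lt
  have hD := h.D_nonneg
  -- At `ξ` the derivative is exactly image length over `2 * r`; distortion transfers this to the
  -- centre `x`.
  obtain ⟨ξ, hξ, hslope⟩ := exists_deriv_eq_slope F^[k] (show x - r < x + r by linarith)
    (h.continuous_iterate k).continuousOn (h.differentiable_iterate k).differentiableOn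
  have hdist := h.distortion k x ξ
  have hmono := h.abs_iterate_sub_mono k (a := x - r) (b := x + r) (x := x) (y := ξ)
    (by linarith) (by linarith) hξ.1.le hξ.2.le
  have hdist' : |Real.log |deriv F^[k] x| - Real.log (|deriv F^[k] ξ|)| ≤ D / (c - 1) * M :=
    hdist.trans (by gcongr; exact hmono.trans hM)
  have hlog : Real.log |deriv F^[k] ξ|
      = Real.log |F^[k] (x + r) - F^[k] (x - r)| - Real.log 2 - Real.log r := by
    rw [hslope, abs_div, show x + r - (x - r) = 2 * r by ring, abs_of_pos (by linarith : 0 < 2 * r),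
      Real.log_div (by linarith) (by linarith), Real.log_mul two_ne_zero hr.ne']
    ring
  have e1 := Real.log_nonneg h1
  have e2 := Real.log_le_log (by linarith) hM
  have e3 := Real.log_pos one_lt_two
  rw [hlog, abs_le] at hdist'
  rw [abs_le]
  constructor <;> linarith [hdist'.1, hdist'.2]

theorem log_growth (h : IsExpandingLift F d c M D) {L : ℝ} {m : ℕ}
    (h1 : |(d : ℝ)| ^ m ≤ 1 + L) (h2 : 1 + L ≤ (1 + ⌈M⌉₊) * |(d : ℝ)| ^ m) :
    m * Real.log |(d : ℝ)| ≤ Real.log (1 + L) ∧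
      Real.log (1 + L) ≤ m * Real.log |(d : ℝ)| + Real.log (1 + ⌈M⌉₊) := by
  have hd : 0 < |(d : ℝ)| := one_pos.trans h.one_lt_abs_degree
  have hpow : 0 < |(d : ℝ)| ^ m := by positivity
  constructor
  · rw [← Real.log_pow]
    exact Real.log_le_log hpow h1
  · rw [← Real.log_pow, add_comm (Real.log _), ← Real.log_mul (by positivity) hpow.ne']
    exact Real.log_le_log (hpow.trans_le h1) h2

/-! ### Entropies -/

/-- The separated sets of the whole circle grow at the rate `log |deg f|`. -/
theorem rate_univ (h : IsExpandingLift F d c M D)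
    (hf : ∀ x : ℝ, f (x : UnitAddCircle) = (F x : UnitAddCircle)) :
    upperRate f (fun _ => Set.univ) = (Real.log |(d : ℝ)| : EReal) ∧
      lowerRate f (fun _ => Set.univ) = (Real.log |(d : ℝ)| : EReal) := by
  have hd := h.one_lt_abs_degree
  have hlogd := Real.log_pos hd
  obtain ⟨k, -, -, hgrow⟩ := h.exists_hitting_time (a := 0 - 1 / 4) (b := 0 + 1 / 4)
    (by norm_num) (by norm_num)
  -- Radius `1 / 4` is the largest allowed inside, radius `1 / 2` covers the circle. The inner
  -- interval lags by its fixed hitting time `k`, which `A` absorbs.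
  obtain ⟨hu, hl⟩ := h.upperRate_lowerRate_eq hf (K := fun _ => Set.univ) (x := 0)
    (A := k * Real.log |(d : ℝ)| + Real.log 2) (ρ := fun _ => 1 / 4) (r := fun _ => 1 / 2)
    (w := fun n => n * Real.log |(d : ℝ)|)
    (Eventually.of_forall fun n => by norm_num) (Eventually.of_forall fun n => Set.subset_univ _)
    (Eventually.of_forall fun n => by
      refine subset_trans (fun w _ => ?_) (closedBall_coe_subset 0 (1 / 2))
      rw [Metric.mem_closedBall, dist_eq_norm]
      simpa using AddCircle.norm_le_half_period 1 one_ne_zero)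
    (Eventually.of_forall fun n => by
      refine le_trans ?_ (h.log_growth (hgrow n).1 (hgrow n).2).1
      have h1 : (n : ℝ) ≤ (n - k : ℕ) + k := by exact_mod_cast (by omega : n ≤ n - k + k)
      have h2 := mul_le_mul_of_nonneg_right h1 hlogd.le
      linarith [Real.log_pos one_lt_two])
    (Eventually.of_forall fun n => by
      have h1 : |F^[n] (0 + 1 / 2) - F^[n] (0 - 1 / 2)| ≤ |(d : ℝ)| ^ n * (1 : ℕ) :=
        h.abs_iterate_sub_le_pow n (by norm_num)
      have h2 : 1 ≤ |(d : ℝ)| ^ n := one_le_pow₀ hd.le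
      have h3 : Real.log (1 + |F^[n] (0 + 1 / 2) - F^[n] (0 - 1 / 2)|)
          ≤ Real.log (2 * |(d : ℝ)| ^ n) :=
        Real.log_le_log (by positivity) (by push_cast at h1; linarith)
      rw [Real.log_mul two_ne_zero (by positivity), Real.log_pow] at h3
      have : 0 ≤ k * Real.log |(d : ℝ)| := by positivity
      linarith)
  have hev : (fun n : ℕ => ((n * Real.log |(d : ℝ)| / n : ℝ) : EReal))
      =ᶠ[atTop] fun _ => (Real.log |(d : ℝ)| : EReal) := by
    filter_upwards [eventually_gt_atTop 0] with n hn
    have : (n : ℝ) ≠ 0 := by exact_mod_cast hn.ne'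
    rw [mul_div_cancel_left₀ _ this]
  rw [limsup_congr hev, limsup_const] at hu
  rw [liminf_congr hev, liminf_const] at hl
  exact ⟨hu, hl⟩

theorem lyapunovRate_coe (h : IsExpandingLift F d c M D)
    (hf : ∀ x : ℝ, f (x : UnitAddCircle) = (F x : UnitAddCircle)) (n : ℕ) (x : ℝ) :
    lyapunovRate f n (x : UnitAddCircle) = Real.log |deriv F^[n] x| / n := by
  unfold lyapunovRate
  rw [circleDeriv_coe (h.continuous_iterate n) (iterate_coe hf n)]

/-- The growth rates of separated subsets of exponentially shrinking balls, and the Lyapunov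
exponents. -/
theorem rate_ball (h : IsExpandingLift F d c M D)
    (hf : ∀ x : ℝ, f (x : UnitAddCircle) = (F x : UnitAddCircle)) {ω : ℝ} (hω : 0 < ω) (x : ℝ) :
    ∃ lsup linf : ℝ, 0 < lsup ∧ 0 < linf ∧
      upperLyapunov f (x : UnitAddCircle) = lsup ∧ lowerLyapunov f (x : UnitAddCircle) = linf ∧
      upperRate f (fun n => closure (Metric.ball (x : UnitAddCircle) (Real.exp (-ω * n))))
        = (max (1 - ω / lsup) 0 * Real.log |(d : ℝ)| : ℝ) ∧
      lowerRate f (fun n => closure (Metric.ball (x : UnitAddCircle) (Real.exp (-ω * n))))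
        = (max (1 - ω / linf) 0 * Real.log |(d : ℝ)| : ℝ) := by
  have hd := h.one_lt_abs_degree
  have hM := h.M_gt_one
  set r : ℕ → ℝ := fun n => Real.exp (-ω * n) with hr
  have hr0 : ∀ n, 0 < r n := fun n => Real.exp_pos _
  have hrsmall : ∀ᶠ n in atTop, r n ≤ 1 / 4 := by
    have : Tendsto r atTop (𝓝 0) := by
      refine Real.tendsto_exp_atBot.comp ?_
      exact tendsto_natCast_atTop_atTop.const_mul_atTop_of_neg (neg_lt_zero.2 hω)
    exact this.eventually_le_const (by norm_num)
  -- Radii are small only eventually; `k n = 0` is a harmless default for the finitely many other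
  -- `n`.
  have hex : ∀ n, ∃ k : ℕ, r n ≤ 1 / 4 →
      1 ≤ |F^[k] (x + r n) - F^[k] (x - r n)| ∧ |F^[k] (x + r n) - F^[k] (x - r n)| ≤ M ∧
      ∀ m, |(d : ℝ)| ^ (m - k) ≤ 1 + |F^[m] (x + r n) - F^[m] (x - r n)| ∧
        1 + |F^[m] (x + r n) - F^[m] (x - r n)| ≤ (1 + ⌈M⌉₊) * |(d : ℝ)| ^ (m - k) := by
    intro n
    by_cases hn : r n ≤ 1 / 4
    · obtain ⟨k, hk⟩ := h.exists_hitting_time (a := x - r n) (b := x + r n)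
        (by linarith [hr0 n]) (by linarith)
      exact ⟨k, fun _ => hk⟩
    · exact ⟨0, fun h => absurd h hn⟩
  choose k hk using hex
  obtain ⟨lsup, linf, hls, hli, e1, e2, e3, e4⟩ := limsup_liminf_hitting
    (ℓ := fun j => Real.log |deriv F^[j] x|) (k := k) (ω := ω)
    (α := Real.log c) (β := Real.log M)
    (A := D / (c - 1) * M + Real.log M + Real.log 2)
    (Real.log_pos h.one_lt) hω (Real.log_pos hd).le (by simp)
    (fun j => by rw [h.log_deriv_iterate_succ]; linarith [h.log_le_log_deriv (F^[j] x)])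
    (fun j => by rw [h.log_deriv_iterate_succ]; linarith [h.log_deriv_le_log (F^[j] x)])
    (hrsmall.mono fun n hn => by
      have := h.abs_log_deriv_add_log_le (hr0 n) (hk n hn).1 (hk n hn).2.1
      rwa [hr, Real.log_exp, neg_mul, ← sub_eq_add_neg] at this)
  have hC : 0 ≤ Real.log (1 + ⌈M⌉₊) :=
    Real.log_nonneg (by linarith [Nat.cast_nonneg (α := ℝ) ⌈M⌉₊])
  obtain ⟨hu, hl⟩ := h.upperRate_lowerRate_eq hf
    (K := fun n => closure (Metric.ball (x : UnitAddCircle) (r n))) (x := x)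
    (A := Real.log (1 + ⌈M⌉₊)) (ρ := r) (r := r)
    (w := fun n => ((n - k n : ℕ) : ℝ) * Real.log |(d : ℝ)|)
    (hrsmall.mono fun n hn => ⟨(hr0 n).le, hn⟩)
    (Eventually.of_forall fun n => image_Icc_subset_closure_ball x (hr0 n))
    (Eventually.of_forall fun n =>
      Metric.closure_ball_subset_closedBall.trans (closedBall_coe_subset x (r n)))
    (hrsmall.mono fun n hn => by
      have := (h.log_growth ((hk n hn).2.2 n).1 ((hk n hn).2.2 n).2).1
      linarith)
    (hrsmall.mono fun n hn => (h.log_growth ((hk n hn).2.2 n).1 ((hk n hn).2.2 n).2).2)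
  refine ⟨lsup, linf, hls, hli, ?_, ?_, hu.trans e3, hl.trans e4⟩
  · rw [← e1]
    simp only [upperLyapunov, h.lyapunovRate_coe hf]
  · rw [← e2]
    simp only [lowerLyapunov, h.lyapunovRate_coe hf]

end IsExpandingLift

/-! ### Passage to the formulas on the circle -/

theorem max_coe_one_sub_div_mul {ω l b : ℝ} (hb : 0 ≤ b) :
    max ((1 - (ω : EReal) / (l : EReal)) * (b : EReal)) 0 = ((max (1 - ω / l) 0 * b : ℝ) : EReal) := by
  rw [← EReal.coe_div, ← EReal.coe_one, ← EReal.coe_sub, ← EReal.coe_mul, ← EReal.coe_zero,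
    ← EReal.coe_strictMono.monotone.map_max, max_mul_of_nonneg _ _ hb, zero_mul]

theorem closure_ball_one_eq_univ (z : UnitAddCircle) {r : ℝ} (hr : 1 ≤ r) :
    closure (Metric.ball z r) = Set.univ := by
  refine Set.eq_univ_of_univ_subset (subset_trans (fun w _ => ?_) subset_closure)
  have : ‖w - z‖ ≤ 1 / 2 := by simpa using AddCircle.norm_le_half_period 1 one_ne_zero
  rw [Metric.mem_ball, dist_eq_norm]
  linarith

end Translocal

theorem theorem2p10 (f : UnitAddCircle → UnitAddCircle)
    (hf : Translocal.IsC2ExpandingCircleMap f) (ω : ℝ) (hω : 0 ≤ ω) (z : UnitAddCircle) :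
    Translocal.upperTranslocalEntropy f ω z =
        max ((1 - (ω : EReal) / Translocal.upperLyapunov f z) * Translocal.topEntropy f) 0 ∧
      Translocal.lowerTranslocalEntropy f ω z =
        max ((1 - (ω : EReal) / Translocal.lowerLyapunov f z) * Translocal.topEntropy f) 0 := by
  open Translocal in
  obtain ⟨F, d, c, M, D, h, hfF⟩ := hf.exists_lift
  obtain ⟨htop, hlow⟩ := h.rate_univ hfF
  have hlogd := Real.log_pos h.one_lt_abs_degree
  have htop' : topEntropy f = (Real.log |(d : ℝ)| : EReal) := htop
  obtain ⟨x, hx : (x : UnitAddCircle) = z⟩ := QuotientAddGroup.mk_surjective z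
  subst hx
  -- For `ω = 0` the balls do not shrink and the hitting-time argument does not apply, but a ball of
  -- radius 1 is the whole circle.
  rcases hω.eq_or_lt with rfl | hω
  · have hball : (fun n : ℕ => closure (Metric.ball (x : UnitAddCircle) (Real.exp (-0 * n))))
        = fun _ => Set.univ := by
      funext n
      exact closure_ball_one_eq_univ _ (by simp)
    constructor
    · rw [upperTranslocalEntropy]
      rw [hball]
      rw [htop, htop', EReal.coe_zero, EReal.zero_div, sub_zero, one_mul]
    · rw [lowerTranslocalEntropy]
      rw [hball]
      rw [hlow, htop', EReal.coe_zero, EReal.zero_div, sub_zero, one_mul]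
  · obtain ⟨lsup, linf, -, -, e1, e2, e3, e4⟩ := h.rate_ball hfF hω x
    have hnn : ∀ l : ℝ, (0 : EReal) ≤ ((max (1 - ω / l) 0 * Real.log |(d : ℝ)| : ℝ) : EReal) :=
      fun l => EReal.coe_nonneg.2 (mul_nonneg (le_max_right _ _) hlogd.le)
    constructor
    · rw [htop']
      rw [e1]
      rw [max_coe_one_sub_div_mul hlogd.le]
      exact (congrArg (max · 0) e3).trans (max_eq_left (hnn _))
    · rw [htop']
      rw [e2]
      rw [max_coe_one_sub_div_mul hlogd.le]
      exact (congrArg (max · 0) e4).trans (max_eq_left (hnn _))
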